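/- Let $A$ be a valuation domain, i.e. a commutative domain such that for all $a,b\in A$ either $a$ divides $b$ or $b$ divides $a$, and assume that its maximal ideal $P$ is not principal. Let $\mathbf D(\operatorname{Mod} A)$ be the unbounded derived category of $A$-modules. A *localization functor* on $\mathbf D(\operatorname{Mod} A)$ is an exact functor $L\colon \mathbf D(\operatorname{Mod} A)\to\mathbf D(\operatorname{Mod} A)$ that admits a natural transformation $\eta\colon \mathrm{Id}\to L$ such that, for all objects $X$, $L\eta_X$ is an isomorphism and $L\eta_X=\eta_{LX}$; its kernel $\operatorname{Ker} L$ is the full subcategory of all $X$ with $LX=0$. A *localizing subcategory* is a full triangulated subcategory closed under isomorphisms, direct summands and arbitrary (small) coproducts. A complex is *perfect* if it is isomorphic in $\mathbf D(\operatorname{Mod} A)$ to a bounded complex of finitely generated projective modules. A localizing subcategory $\mathcal C$ is *generated by perfect complexes* if no proper localizing subcategory of $\mathcal C$ contains all perfect complexes belonging to $\mathcal C$. The *telescope conjecture* for $\mathbf D(\operatorname{Mod} A)$ is the assertion that every localizing subcategory of the form $\operatorname{Ker} L$, with $L$ a coproduct preserving localization functor, is generated by perfect complexes. Then the telescope conjecture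 fails for $\mathbf D(\operatorname{Mod} A)$. More precisely, the derived tensor functor $$L=-\otimes^{\mathbf L}_A A/P\colon \mathbf D(\operatorname{Mod} A)\to\mathbf D(\operatorname{Mod} A)$$ (the total left derived functor of $-\otimes_A A/P$ on complexes) exists and is a coproduct preserving localization functor. Its kernel is a localizing subcategory that is non-trivial: it contains $P$ (as a complex concentrated in degree $0$), and $P\neq 0$ in $\mathbf D(\operatorname{Mod} A)$. However, $\operatorname{Ker} L$ contains no non-zero perfect complex and is not generated by perfect complexes. -/

import Mathlib

open CategoryTheory Limits

universe w u

namespace Telescope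

variable (A : Type u) [CommRing A]

/-- The unbounded derived category of `A`-modules. -/
abbrev DMod [HasDerivedCategory.{w} (ModuleCat.{u} A)] : Type (u + 1) :=
  DerivedCategory (ModuleCat.{u} A)

/-- The functor on unbounded cochain complexes of `A`-modules which tensors every term
with the module `M` on the right. -/
noncomputable abbrev tensorComplex (M : ModuleCat.{u} A) :
    CochainComplex (ModuleCat.{u} A) ℤ ⥤ CochainComplex (ModuleCat.{u} A) ℤ :=
  (MonoidalCategory.tensorRight M).mapHomologicalComplex (ComplexShape.up ℤ)

variable {A}
variable [HasDerivedCategory.{w} (ModuleCat.{u} A)]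

/-- `L` is the derived tensor product functor `- ⊗ᴸ M` on the unbounded derived category, i.e. it
is a total left derived functor of `- ⊗ M` (on cochain complexes, with respect to the
quasi-isomorphisms). Such an `L` is unique up to a unique isomorphism compatible with the
comparison transformation `α`. -/
def IsDerivedTensor (M : ModuleCat.{u} A) (L : DMod.{w} A ⥤ DMod.{w} A) : Prop :=
  ∃ α : DerivedCategory.Q ⋙ L ⟶ tensorComplex A M ⋙ DerivedCategory.Q,
    L.IsLeftDerivedFunctor α
      (HomologicalComplex.quasiIso (ModuleCat.{u} A) (ComplexShape.up ℤ))

/-- A localization functor on the derived category: an exact functor `L` which admits a natural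
transformation `η : 𝟭 ⟶ L` such that `L η_X` is an isomorphism and `L η_X = η_{L X}`
for every object `X`. -/
def IsLocalizationFunctor (L : DMod.{w} A ⥤ DMod.{w} A) : Prop :=
  (∃ _ : L.CommShift ℤ, L.IsTriangulated) ∧
    ∃ η : 𝟭 (DMod.{w} A) ⟶ L, ∀ X : DMod.{w} A,
      IsIso (L.map (η.app X)) ∧ L.map (η.app X) = η.app (L.obj X)

/-- `L` preserves all (small) coproducts. -/
def PreservesAllCoproducts (L : DMod.{w} A ⥤ DMod.{w} A) : Prop :=
  ∀ J : Type u, PreservesColimitsOfShape (Discrete J) L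

/-- The kernel of `L`: the full subcategory of the objects which `L` sends to zero. -/
def kernel (L : DMod.{w} A ⥤ DMod.{w} A) : ObjectProperty (DMod.{w} A) :=
  fun X => IsZero (L.obj X)

/-- A localizing subcategory: a thick subcategory (a full triangulated subcategory, closed under
isomorphisms and direct summands) which is closed under all (small) coproducts. -/
structure IsLocalizingSubcategory (C : ObjectProperty (DMod.{w} A)) : Prop where
  closedUnderIso : C.IsClosedUnderIsomorphisms
  triangulated : C.IsTriangulated
  directSummands : C.IsStableUnderRetracts
  coproducts : ∀ J : Type u, C.IsClosedUnderColimitsOfShape (Discrete J)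

/-- An object of the derived category is perfect if it is isomorphic to a bounded complex of
finitely generated projective modules. -/
def IsPerfect (X : DMod.{w} A) : Prop :=
  ∃ K : CochainComplex (ModuleCat.{u} A) ℤ,
    (∃ a b : ℤ, K.IsStrictlyGE a ∧ K.IsStrictlyLE b) ∧
    (∀ n : ℤ, Module.Finite A (K.X n) ∧ Module.Projective A (K.X n)) ∧
    Nonempty (X ≅ DerivedCategory.Q.obj K)

/-- The localizing subcategory `C` is generated by perfect complexes: it admits no proper
localizing subcategory containing all perfect complexes from `C`. -/
def IsGeneratedByPerfect (C : ObjectProperty (DMod.{w} A)) : Prop :=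
  ∀ D : ObjectProperty (DMod.{w} A), IsLocalizingSubcategory D → D ≤ C →
    (∀ X, C X → IsPerfect X → D X) → D = C

variable (A) in
/-- The telescope conjecture for the derived category of `A`-modules: every localizing
subcategory which is the kernel of a coproduct preserving localization functor is generated by
perfect complexes. -/
def TelescopeConjecture : Prop :=
  ∀ C : ObjectProperty (DMod.{w} A), IsLocalizingSubcategory C →
    (∃ L : DMod.{w} A ⥤ DMod.{w} A,
      IsLocalizationFunctor L ∧ PreservesAllCoproducts L ∧ C = kernel L) →
    IsGeneratedByPerfect C

end Telescope

/-! Since `P` is not principal, `P * P = P`; being torsion-free over a valuation ring, `P` is flat.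
So `T = - ⊗ P` is exact, and the multiplication `ε : T ⟶ 𝟭` becomes invertible after applying `T` on
either side (`rTensor_tensorMul_bijective`). Both properties pass to the derived category. Formally,
`X ↦ cone (T X ⟶ X)` is then the reflection onto the kernel of `T`, hence a localization functor
(`IdempotentAugmentation.localization`). It preserves coproducts because the kernel of `T` is closed
under them.

For a complex `K` with flat terms, `0 ⟶ K ⊗ P ⟶ K ⊗ A ⟶ K ⊗ A/P ⟶ 0` is exact in each degree, so
this cone is `K ⊗ A/P`. Every complex has a functorial resolution with torsion-free, hence flat,
terms, so the reflection is the derived tensor product with `A/P`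
(`isDerivedTensor_idealLocalization`).

A complex `K` lies in the kernel of the localization iff `K ⊗ P ⟶ K` is a quasi-isomorphism. This
holds for `P = T A`. If the terms of `K` are finite projective, it places every cycle in `P K` plus
boundaries, and Nakayama makes `K` acyclic (`ker_le_range_of_mem_sup`). So the zero subcategory
already contains all perfect complexes of the kernel, whereas `P ≠ 0` lies in it. -/

open ZeroObject

/-! ### Exact colimits of complexes -/

namespace HomologicalComplex

variable {C ι J : Type*} [Category* C] [Abelian C] [Category* J] {c : ComplexShape ι}

/-- The differential of a diagram of complexes. -/
@[simps]
def diagramD (F : J ⥤ HomologicalComplex C c) (i k : ι) : F ⋙ eval C c i ⟶ F ⋙ eval C c k where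
  app j := (F.obj j).d i k
  naturality _ _ f := (F.map f).comm i k

/-- The short complexes in degree `i` attached to a diagram of complexes, as a
short complex of diagrams. -/
@[simps]
noncomputable def diagramSc (F : J ⥤ HomologicalComplex C c) (i : ι) : ShortComplex (J ⥤ C) where
  f := diagramD F (c.prev i) i
  g := diagramD F i (c.next i)
  zero := by ext j; exact (F.obj j).d_comp_d _ _ _

/-- A natural transformation between diagrams of complexes induces a morphism on the
associated short complexes of diagrams. -/
@[simps]
noncomputable def diagramScMap {F G : J ⥤ HomologicalComplex C c} (φ : F ⟶ G) (i : ι) :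
    diagramSc F i ⟶ diagramSc G i where
  τ₁ := Functor.whiskerRight φ (eval C c _)
  τ₂ := Functor.whiskerRight φ (eval C c _)
  τ₃ := Functor.whiskerRight φ (eval C c _)
  comm₁₂ := by ext j; exact (φ.app j).comm _ _
  comm₂₃ := by ext j; exact (φ.app j).comm _ _

/-- Evaluation at `j` is exact, so homology of diagrams is computed pointwise. -/
lemma quasiIso_diagramScMap {F G : J ⥤ HomologicalComplex C c}
    (φ : F ⟶ G) [∀ j, QuasiIso (φ.app j)] (i : ι) : ShortComplex.QuasiIso (diagramScMap φ i) := by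
  rw [ShortComplex.quasiIso_iff, NatTrans.isIso_iff_isIso_app]
  intro j
  let E := (evaluation J C).obj j
  have h : IsIso (ShortComplex.homologyMap (E.mapShortComplex.map (diagramScMap φ i))) := by
    rw [← ShortComplex.quasiIso_iff]
    exact (quasiIsoAt_iff (φ.app j) i).1 inferInstance
  exact (NatIso.isIso_map_iff (ShortComplex.homologyFunctorIso E) (diagramScMap φ i)).1 h

variable [HasColimitsOfShape J C]

/-- Colimits of complexes are computed degreewise. -/
noncomputable def colimitXIso (F : J ⥤ HomologicalComplex C c) (i : ι) :
    (colimit F).X i ≅ colimit (F ⋙ eval C c i) :=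
  preservesColimitIso (eval C c i) F

lemma ι_f_colimitXIso_hom (F : J ⥤ HomologicalComplex C c) (i : ι) (j : J) :
    (colimit.ι F j).f i ≫ (colimitXIso F i).hom = colimit.ι (F ⋙ eval C c i) j :=
  ι_preservesColimitIso_hom (eval C c i) F j

lemma ι_f_colimitXIso_hom_assoc (F : J ⥤ HomologicalComplex C c) (i : ι) (j : J) {Z : C}
    (h : colimit (F ⋙ eval C c i) ⟶ Z) :
    (colimit.ι F j).f i ≫ (colimitXIso F i).hom ≫ h = colimit.ι (F ⋙ eval C c i) j ≫ h := by
  rw [← Category.assoc]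
  exact congrArg (· ≫ h) (ι_f_colimitXIso_hom F i j)

lemma colimit_X_hom_ext {F : J ⥤ HomologicalComplex C c} {i : ι} {Z : C}
    {f g : (colimit F).X i ⟶ Z}
    (h : ∀ j, (colimit.ι F j).f i ≫ f = (colimit.ι F j).f i ≫ g) : f = g :=
  (isColimitOfPreserves (eval C c i) (colimit.isColimit F)).hom_ext h

lemma colimitXIso_hom_comm (F : J ⥤ HomologicalComplex C c) (i k : ι) :
    (colimitXIso F i).hom ≫ colimMap (diagramD F i k) =
      (colimit F).d i k ≫ (colimitXIso F k).hom :=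
  colimit_X_hom_ext fun j ↦ by
    rw [ι_f_colimitXIso_hom_assoc, Hom.comm_assoc, ι_f_colimitXIso_hom]
    exact ι_colimMap _ _

lemma colimitXIso_hom_naturality {F G : J ⥤ HomologicalComplex C c} (φ : F ⟶ G) (i : ι) :
    (colimitXIso F i).hom ≫ colimMap (Functor.whiskerRight φ (eval C c i)) =
      (colimMap φ).f i ≫ (colimitXIso G i).hom :=
  colimit_X_hom_ext fun j ↦ by
    have h : (colimit.ι F j).f i ≫ (colimMap φ).f i = (φ.app j).f i ≫ (colimit.ι G j).f i := by
      rw [← comp_f, ι_colimMap, comp_f]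
    rw [ι_f_colimitXIso_hom_assoc, reassoc_of% h, ι_f_colimitXIso_hom]
    exact ι_colimMap _ _

/-- For a diagram of complexes, the short complex in degree `i` of the colimit is the
colimit of the short complexes in degree `i`. -/
noncomputable def scColimitIso (F : J ⥤ HomologicalComplex C c) (i : ι) :
    (colimit F).sc i ≅ (colim (J := J) (C := C)).mapShortComplex.obj (diagramSc F i) :=
  ShortComplex.isoMk (colimitXIso F _) (colimitXIso F _) (colimitXIso F _)
    (colimitXIso_hom_comm F _ _) (colimitXIso_hom_comm F _ _)

/-- Exact colimits of quasi-isomorphisms are quasi-isomorphisms. -/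
lemma quasiIso_colimMap [HasExactColimitsOfShape J C] {F G : J ⥤ HomologicalComplex C c}
    (φ : F ⟶ G) [∀ j, QuasiIso (φ.app j)] : QuasiIso (colimMap φ) where
  quasiIsoAt i := by
    have := quasiIso_diagramScMap φ i
    rw [quasiIsoAt_iff]
    have h : ShortComplex.QuasiIso
        ((colim (J := J) (C := C)).mapShortComplex.map (diagramScMap φ i)) := inferInstance
    refine (ShortComplex.quasiIso_iff_of_arrow_mk_iso _ _
      (Arrow.isoMk (scColimitIso F i) (scColimitIso G i) ?_)).2 h
    ext : 1
    all_goals exact colimitXIso_hom_naturality φ _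

end HomologicalComplex

/-! ### Coproducts in the derived category -/

namespace DerivedCategory

variable {C : Type*} [Category* C] [Abelian C] [HasDerivedCategory.{w} C]

lemma isZero_Q_obj_of_isZero {K : CochainComplex C ℤ} (hK : IsZero K) : IsZero (Q.obj K) :=
  Functor.map_isZero _ hK

lemma isZero_Q_obj_iff (K : CochainComplex C ℤ) : IsZero (Q.obj K) ↔ K.Acyclic := by
  have : IsIso (Q.map (0 : K ⟶ 0)) ↔ IsZero (Q.obj K) := by
    constructor
    · intro h
      exact (isZero_Q_obj_of_isZero (isZero_zero _)).of_iso (asIso (Q.map (0 : K ⟶ 0)))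
    · intro h
      exact ⟨0, h.eq_of_src _ _, (isZero_Q_obj_of_isZero (isZero_zero _)).eq_of_src _ _⟩
  rw [← this, isIso_Q_map_iff_quasiIso]
  have h0 : (0 : CochainComplex C ℤ).Acyclic :=
    HomologicalComplex.acyclic_of_isZero _ (isZero_zero _)
  constructor
  · intro h i
    exact (quasiIsoAt_iff_exactAt' _ i (h0 i)).1 (h.quasiIsoAt i)
  · intro h
    exact ⟨fun i ↦ (quasiIsoAt_iff_exactAt' _ i (h0 i)).2 (h i)⟩

/-- A morphism of complexes which vanishes in the derived category factors through an
acyclic complex. -/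
lemma exists_fac_acyclic_of_Q_map_eq_zero {K L : CochainComplex C ℤ} (f : K ⟶ L)
    (hf : Q.map f = 0) :
    ∃ (Z : CochainComplex C ℤ) (_ : Z.Acyclic) (a : K ⟶ Z) (b : Z ⟶ L), a ≫ b = f := by
  let q := HomotopyCategory.quotient C (ComplexShape.up ℤ)
  have h : Qh.map (q.map f) = Qh.map 0 := by
    rw [← cancel_mono ((quotientCompQhIso C).hom.app L)]
    refine (quotientCompQhIso_hom_naturality f).trans ?_
    rw [hf, Functor.map_zero]
    exact comp_zero.trans zero_comp.symm
  rw [MorphismProperty.map_eq_iff_precomp Qh (HomotopyCategory.quasiIso C (ComplexShape.up ℤ))] at h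
  obtain ⟨K', s, hs, eq⟩ := h
  obtain ⟨K', rfl⟩ := HomotopyCategory.quotient_obj_surjective K'
  obtain ⟨s, rfl⟩ := q.map_surjective s
  rw [comp_zero, ← q.map_comp] at eq
  have H : Homotopy (s ≫ f) 0 := HomotopyCategory.homotopyOfEq _ _ (by rw [eq, q.map_zero])
  -- The cone of the quasi-isomorphism `s` is acyclic, and the null-homotopy of `s ≫ f` is exactly
  -- what extends `f` to it.
  refine ⟨CochainComplex.mappingCone s, ?_, CochainComplex.mappingCone.inr s,
    CochainComplex.mappingCone.desc s (CochainComplex.HomComplex.Cochain.ofHomotopy H) f ?_, ?_⟩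
  · rw [← isZero_Q_obj_iff]
    refine (Pretriangulated.Triangle.isZero₃_iff_isIso₁ _
      (mappingCone_triangle_distinguished s)).2 ?_
    change IsIso (Q.map s)
    rw [isIso_Q_map_iff_quasiIso]
    exact (HomotopyCategory.quotient_map_mem_quasiIso_iff s).1 hs
  · simp
  · simp

section Coproducts

variable {J : Type*} [HasColimitsOfShape (Discrete J) C]
  [HasExactColimitsOfShape (Discrete J) C]

open Functor in
lemma acyclic_sigma (Z : J → CochainComplex C ℤ) (hZ : ∀ j, (Z j).Acyclic) :
    (∐ Z).Acyclic := by
  have h (j : J) : QuasiIso (0 : Z j ⟶ 0) := by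
    rw [← isIso_Q_map_iff_quasiIso]
    exact ⟨0, ((isZero_Q_obj_iff _).2 (hZ j)).eq_of_src _ _,
      (isZero_Q_obj_of_isZero (isZero_zero _)).eq_of_src _ _⟩
  have : ∀ j, QuasiIso ((Discrete.natTrans (fun j ↦ (0 : Z j.as ⟶ 0)) :
    Discrete.functor Z ⟶ Discrete.functor fun _ ↦ 0).app j) := fun j ↦ h j.as
  have := HomologicalComplex.quasiIso_colimMap (C := C)
    (Discrete.natTrans (fun j ↦ (0 : Z j.as ⟶ 0)) :
      Discrete.functor Z ⟶ Discrete.functor fun _ ↦ 0)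
  rw [← isIso_Q_map_iff_quasiIso] at this
  rw [← isZero_Q_obj_iff]
  refine IsZero.of_iso (isZero_Q_obj_of_isZero ?_) (asIso (Q.map (colimMap
    (Discrete.natTrans (fun j ↦ (0 : Z j.as ⟶ 0)) :
      Discrete.functor Z ⟶ Discrete.functor fun _ ↦ 0))))
  rw [IsZero.iff_id_eq_zero]
  ext j : 1
  exact (isZero_zero _).eq_of_src _ _

/-- Uniqueness half of the universal property: if all components vanish, each factors through an
acyclic complex, so the whole map factors through a coproduct of acyclic complexes, again acyclic.
-/
lemma Q_sigma_hom_ext {K : J → CochainComplex C ℤ} {Y : DerivedCategory C}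
    {f g : Q.obj (∐ K) ⟶ Y} (h : ∀ j, Q.map (Sigma.ι K j) ≫ f = Q.map (Sigma.ι K j) ≫ g) :
    f = g := by
  suffices ∀ (L : CochainComplex C ℤ) (f : Q.obj (∐ K) ⟶ Q.obj L),
      (∀ j, Q.map (Sigma.ι K j) ≫ f = 0) → f = 0 by
    rw [← sub_eq_zero, ← cancel_mono (Q.objObjPreimageIso Y).inv, zero_comp]
    refine this _ _ fun j ↦ ?_
    rw [Preadditive.sub_comp, Preadditive.comp_sub, reassoc_of% (h j), sub_self]
  clear h f g
  intro L f hf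
  obtain ⟨L', g, s, _, rfl⟩ := left_fac f
  have hg (j : J) : Q.map (Sigma.ι K j ≫ g) = 0 := by
    have := hf j
    rwa [← Category.assoc, ← Q.map_comp, IsIso.comp_inv_eq, zero_comp] at this
  choose Z hZ a b fac using fun j ↦ exists_fac_acyclic_of_Q_map_eq_zero _ (hg j)
  have hg' : g = Limits.Sigma.map a ≫ Sigma.desc b := by
    ext1 j
    simp [fac]
  have : Q.map g = 0 := by
    rw [hg', Q.map_comp, ((isZero_Q_obj_iff _).2 (acyclic_sigma Z hZ)).eq_of_tgt (Q.map _) 0,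
      zero_comp]
  rw [this, zero_comp]

/-- Existence half: write the components as fractions; the coproduct of their denominators is still
a quasi-isomorphism. -/
lemma exists_Q_sigma_desc {K : J → CochainComplex C ℤ} {Y : DerivedCategory C}
    (f : ∀ j, Q.obj (K j) ⟶ Y) :
    ∃ g : Q.obj (∐ K) ⟶ Y, ∀ j, Q.map (Sigma.ι K j) ≫ g = f j := by
  suffices ∀ (L : CochainComplex C ℤ) (f : ∀ j, Q.obj (K j) ⟶ Q.obj L),
      ∃ g : Q.obj (∐ K) ⟶ Q.obj L, ∀ j, Q.map (Sigma.ι K j) ≫ g = f j by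
    obtain ⟨g, hg⟩ := this _ (fun j ↦ f j ≫ (Q.objObjPreimageIso Y).inv)
    exact ⟨g ≫ (Q.objObjPreimageIso Y).hom, fun j ↦ by simp [reassoc_of% (hg j)]⟩
  clear f
  intro L f
  choose K' s hs g fac using fun j ↦ right_fac (f j)
  have : ∀ j, QuasiIso ((Discrete.natTrans (fun j ↦ s j.as) :
    Discrete.functor K' ⟶ Discrete.functor K).app j) :=
      fun j ↦ (isIso_Q_map_iff_quasiIso _ _).1 (hs j.as)
  have := HomologicalComplex.quasiIso_colimMap (Discrete.natTrans (fun j ↦ s j.as) :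
    Discrete.functor K' ⟶ Discrete.functor K)
  rw [← isIso_Q_map_iff_quasiIso] at this
  have : IsIso (Q.map (Limits.Sigma.map s)) := this
  refine ⟨inv (Q.map (Limits.Sigma.map s)) ≫ Q.map (Sigma.desc g), fun j ↦ ?_⟩
  rw [fac, ← cancel_epi (Q.map (s j)), IsIso.hom_inv_id_assoc, ← Q.map_comp_assoc,
    ← Sigma.ι_map, Q.map_comp_assoc, IsIso.hom_inv_id_assoc, ← Q.map_comp, Sigma.ι_desc]

/-- The image in the derived category of a coproduct of complexes is a coproduct. -/
noncomputable def isColimitQSigma (K : J → CochainComplex C ℤ) :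
    IsColimit (Cofan.mk (Q.obj (∐ K)) (fun j ↦ Q.map (Sigma.ι K j))) :=
  Cofan.IsColimit.mk _ (fun s ↦ (exists_Q_sigma_desc s.inj).choose)
    (fun s j ↦ (exists_Q_sigma_desc s.inj).choose_spec j)
    (fun s _ hm ↦ Q_sigma_hom_ext fun j ↦
      (hm j).trans ((exists_Q_sigma_desc s.inj).choose_spec j).symm)

instance hasColimitsOfShape_discrete : HasColimitsOfShape (Discrete J) (DerivedCategory C) where
  has_colimit F := by
    let K (j : J) := Q.objPreimage (F.obj ⟨j⟩)
    let e : F ≅ Discrete.functor fun j ↦ Q.obj (K j) :=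
      Discrete.natIso fun j ↦ (Q.objObjPreimageIso (F.obj j)).symm
    have : HasColimit (Discrete.functor fun j ↦ Q.obj (K j)) := ⟨⟨⟨_, isColimitQSigma K⟩⟩⟩
    exact hasColimit_of_iso e

/-- A property of objects in the derived category is closed under coproducts if it is so
for coproducts of complexes. -/
lemma isClosedUnderColimitsOfShape_discrete_of_sigma (P : ObjectProperty (DerivedCategory C))
    [P.IsClosedUnderIsomorphisms]
    (h : ∀ K : J → CochainComplex C ℤ, (∀ j, P (Q.obj (K j))) → P (Q.obj (∐ K))) :
    P.IsClosedUnderColimitsOfShape (Discrete J) where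
  colimitsOfShape_le := by
    rintro X ⟨p⟩
    let K (j : J) := Q.objPreimage (p.diag.obj ⟨j⟩)
    let e : p.diag ≅ Discrete.functor fun j ↦ Q.obj (K j) :=
      Discrete.natIso fun j ↦ (Q.objObjPreimageIso (p.diag.obj j)).symm
    exact P.prop_of_iso (IsColimit.coconePointsIsoOfNatIso p.isColimit (isColimitQSigma K) e).symm
      (h K fun j ↦ P.prop_of_iso (Q.objObjPreimageIso _).symm (p.prop_diag_obj ⟨j⟩))

end Coproducts

end DerivedCategory

/-! ### Localization functors from idempotent augmentations -/

namespace CategoryTheory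

open Pretriangulated

namespace Functor

section

variable {C D : Type*} [Category* C] [Category* D]

/-- The property of the objects which are sent to zero by a functor. -/
def kernelProperty (F : C ⥤ D) : ObjectProperty C := fun X ↦ IsZero (F.obj X)

instance (F : C ⥤ D) : F.kernelProperty.IsClosedUnderIsomorphisms where
  of_iso e h := IsZero.of_iso h (F.mapIso e.symm)

instance [HasZeroMorphisms D] (F : C ⥤ D) : F.kernelProperty.IsStableUnderRetracts where
  of_retract {X Y} r (h : IsZero (F.obj Y)) := by
    have := (r.map F).retract
    refine (IsZero.iff_id_eq_zero _).2 ?_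
    rw [← this, h.eq_of_src (r.map F).r 0, comp_zero]

lemma kernelProperty_isClosedUnderColimitsOfShape [HasZeroMorphisms D] (F : C ⥤ D) (J : Type*)
    [Category* J] [PreservesColimitsOfShape J F] :
    F.kernelProperty.IsClosedUnderColimitsOfShape J where
  colimitsOfShape_le := by
    rintro X ⟨p⟩
    refine (IsZero.iff_id_eq_zero _).2 ((isColimitOfPreserves F p.isColimit).hom_ext fun j ↦ ?_)
    exact (p.prop_diag_obj j : IsZero _).eq_of_src _ _

variable [Preadditive C] [HasZeroObject C] [HasShift C ℤ]
  [∀ n : ℤ, (shiftFunctor C n).Additive] [Pretriangulated C]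
  [Preadditive D] [HasZeroObject D] [HasShift D ℤ]
  [∀ n : ℤ, (shiftFunctor D n).Additive] [Pretriangulated D]

instance (F : C ⥤ D) [F.CommShift ℤ] [F.IsTriangulated] : F.kernelProperty.IsTriangulated where
  exists_zero := ⟨0, isZero_zero C, F.map_isZero (isZero_zero C)⟩
  isStableUnderShiftBy n := ⟨fun X (hX : IsZero (F.obj X)) ↦
    ((shiftFunctor D n).map_isZero hX).of_iso ((F.commShiftIso n).app X)⟩
  toIsTriangulatedClosed₂ := .mk' fun T hT h₁ h₃ ↦
    (F.mapTriangle.obj T).isZero₂_of_isZero₁₃ (F.map_distinguished T hT) h₁ h₃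

end

end Functor

/-- A triangulated endofunctor `T` with an augmentation `T ⟶ 𝟭` which is idempotent in the
sense that both morphisms `T (T X) ⟶ T X` are isomorphisms. -/
structure IdempotentAugmentation {D : Type*} [Category* D] (T : D ⥤ D) where
  /-- the augmentation -/
  ε : T ⟶ 𝟭 D
  isIso_map_app (X : D) : IsIso (T.map (ε.app X))
  isIso_app_obj (X : D) : IsIso (ε.app (T.obj X))

namespace IdempotentAugmentation

variable {D : Type*} [Category* D] [Preadditive D] {T : D ⥤ D} (A : IdempotentAugmentation T)

attribute [instance] isIso_map_app isIso_app_obj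

include A in
-- By naturality, precomposing `f` with the isomorphism `ε` at `T X` gives a map through `T Y = 0`.
lemma hom_eq_zero {X Y : D} (hY : T.kernelProperty Y) (f : T.obj X ⟶ Y) : f = 0 := by
  rw [← cancel_epi (A.ε.app (T.obj X))]
  have := A.ε.naturality f
  dsimp at this
  rw [← this, (hY : IsZero _).eq_of_tgt (T.map f) 0, zero_comp, comp_zero]

variable [HasZeroObject D] [HasShift D ℤ] [∀ n : ℤ, (shiftFunctor D n).Additive]
  [Pretriangulated D]

/-- The cone of the augmentation. -/
noncomputable def localObj (X : D) : D := (distinguished_cocone_triangle (A.ε.app X)).choose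

/-- The morphism to the cone of the augmentation. -/
noncomputable def toLocalObj (X : D) : X ⟶ A.localObj X :=
  (distinguished_cocone_triangle (A.ε.app X)).choose_spec.choose

/-- The connecting morphism of the cone of the augmentation. -/
noncomputable def localObjδ (X : D) : A.localObj X ⟶ (T.obj X)⟦(1 : ℤ)⟧ :=
  (distinguished_cocone_triangle (A.ε.app X)).choose_spec.choose_spec.choose

lemma localObj_distinguished (X : D) :
    Triangle.mk (A.ε.app X) (A.toLocalObj X) (A.localObjδ X) ∈ distTriang D :=
  (distinguished_cocone_triangle (A.ε.app X)).choose_spec.choose_spec.choose_spec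

variable [T.CommShift ℤ]

/-- In the long exact sequence of maps into `Y`, the terms at `T X` and its shift vanish by
`hom_eq_zero`. -/
lemma bijective_precomp {X Z : D} {g : X ⟶ Z} {h : Z ⟶ (T.obj X)⟦(1 : ℤ)⟧}
    (hT : Triangle.mk (A.ε.app X) g h ∈ distTriang D) {Y : D} (hY : T.kernelProperty Y) :
    Function.Bijective fun f : Z ⟶ Y ↦ g ≫ f := by
  constructor
  · intro a b (hab : g ≫ a = g ≫ b)
    rw [← sub_eq_zero]
    obtain ⟨c, hc⟩ := Triangle.yoneda_exact₃ _ hT (a - b)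
      ((Preadditive.comp_sub _ _ _).trans (sub_eq_zero.2 hab))
    have (c : (T.obj X)⟦(1 : ℤ)⟧ ⟶ Y) : c = 0 := by
      rw [← cancel_epi ((T.commShiftIso (1 : ℤ)).hom.app X), comp_zero]
      exact A.hom_eq_zero hY _
    rw [hc, this c]
    exact comp_zero
  · intro f
    obtain ⟨c, hc⟩ := Triangle.yoneda_exact₂ _ hT f (A.hom_eq_zero hY _)
    exact ⟨c, hc.symm⟩

variable [T.IsTriangulated]

lemma kernelProperty_of_distinguished {X Z : D} {g : X ⟶ Z} {h : Z ⟶ (T.obj X)⟦(1 : ℤ)⟧}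
    (hT : Triangle.mk (A.ε.app X) g h ∈ distTriang D) : T.kernelProperty Z :=
  (Triangle.isZero₃_iff_isIso₁ _ (T.map_distinguished _ hT)).2 (A.isIso_map_app X)

/-- The universal property of the cone of the augmentation. -/
noncomputable def reflectorEquiv (X : D) (Y : T.kernelProperty.FullSubcategory) :
    ((⟨A.localObj X, A.kernelProperty_of_distinguished (A.localObj_distinguished X)⟩ :
      T.kernelProperty.FullSubcategory) ⟶ Y) ≃ (X ⟶ T.kernelProperty.ι.obj Y) :=
  T.kernelProperty.fullyFaithfulι.homEquiv.trans
    (Equiv.ofBijective _ (A.bijective_precomp (A.localObj_distinguished X) Y.property))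

/-- The left adjoint of the inclusion of the kernel. -/
noncomputable def reflector : D ⥤ T.kernelProperty.FullSubcategory :=
  Adjunction.leftAdjointOfEquiv A.reflectorEquiv (fun _ _ _ _ _ ↦ (Category.assoc _ _ _).symm)

/-- The kernel of `T` is a reflective subcategory. -/
noncomputable def reflectorAdj : A.reflector ⊣ T.kernelProperty.ι :=
  Adjunction.adjunctionOfEquivLeft A.reflectorEquiv (fun _ _ _ _ _ ↦ (Category.assoc _ _ _).symm)

/-- The localization functor which sends `X` to the cone of `T X ⟶ X`. -/
noncomputable def localization : D ⥤ D := A.reflector ⋙ T.kernelProperty.ι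

/-- The unit of the localization functor. -/
noncomputable def unit : 𝟭 D ⟶ A.localization := A.reflectorAdj.unit

lemma kernelProperty_localization_obj (X : D) : T.kernelProperty (A.localization.obj X) :=
  (A.reflector.obj X).property

lemma unit_app (X : D) : A.unit.app X = A.toLocalObj X := by
  have := Adjunction.adjunctionOfEquivLeft_unit_app A.reflectorEquiv
    (fun _ _ _ _ _ ↦ (Category.assoc _ _ _).symm) X
  exact this.trans (Category.comp_id _)

lemma unit_distinguished (X : D) : ∃ h : A.localization.obj X ⟶ (T.obj X)⟦(1 : ℤ)⟧,
    Triangle.mk (A.ε.app X) (A.unit.app X) h ∈ distTriang D :=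
  ⟨A.localObjδ X, by rw [unit_app]; exact A.localObj_distinguished X⟩

lemma bijective_unit_precomp (X : D) {Y : D} (hY : T.kernelProperty Y) :
    Function.Bijective fun f : A.localization.obj X ⟶ Y ↦ A.unit.app X ≫ f :=
  A.bijective_precomp (A.unit_distinguished X).choose_spec hY

lemma isIso_unit_app_of_kernelProperty {X : D} (hX : T.kernelProperty X) :
    IsIso (A.unit.app X) :=
  (Triangle.isZero₁_iff_isIso₂ _ (A.unit_distinguished X).choose_spec).1 hX

/-- Both maps agree after precomposition with the unit, by naturality, and their common target lies
in the kernel of `T`. -/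
lemma map_unit_app (X : D) :
    A.localization.map (A.unit.app X) = A.unit.app (A.localization.obj X) :=
  (A.bijective_unit_precomp X (A.kernelProperty_localization_obj _)).1
    (A.unit.naturality (A.unit.app X)).symm

lemma isIso_map_unit_app (X : D) : IsIso (A.localization.map (A.unit.app X)) := by
  rw [map_unit_app]
  exact A.isIso_unit_app_of_kernelProperty (A.kernelProperty_localization_obj X)

/-- The reflector is left adjoint to a triangulated inclusion, hence itself triangulated. -/
lemma exists_isTriangulated_localization :
    ∃ _ : A.localization.CommShift ℤ, A.localization.IsTriangulated := by
  let := A.reflectorAdj.leftAdjointCommShift ℤ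
  have := A.reflectorAdj.commShift_of_rightAdjoint ℤ
  have := A.reflectorAdj.isTriangulated_leftAdjoint
  exact ⟨(inferInstance : (A.reflector ⋙ T.kernelProperty.ι).CommShift ℤ),
    (inferInstance : (A.reflector ⋙ T.kernelProperty.ι).IsTriangulated)⟩

lemma preservesColimitsOfShape_localization (J : Type*) [Category* J] [HasColimitsOfShape J D]
    [T.kernelProperty.IsClosedUnderColimitsOfShape J] :
    PreservesColimitsOfShape J A.localization := by
  have := A.reflectorAdj.leftAdjoint_preservesColimits
  exact (inferInstance : PreservesColimitsOfShape J (A.reflector ⋙ T.kernelProperty.ι))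

lemma isZero_localization_obj_iff (X : D) :
    IsZero (A.localization.obj X) ↔ IsIso (A.ε.app X) :=
  Triangle.isZero₃_iff_isIso₁ _ (A.unit_distinguished X).choose_spec

end IdempotentAugmentation

end CategoryTheory

/-! ### Left derived functors from functorial resolutions -/

namespace CategoryTheory

namespace Functor

variable {C D H : Type*} [Category* C] [Category* D] [Category* H] {Q : C ⥤ D} {F : C ⥤ H}
  {LF : D ⥤ H} (α : Q ⋙ LF ⟶ F) (W : MorphismProperty C) [Q.IsLocalization W]
  {R : C ⥤ C} (p : R ⟶ 𝟭 C)

/-- Lifting of natural transformations to a functor which is computed by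
a functorial resolution. -/
noncomputable def resolutionLift (hp : ∀ X, IsIso (Q.map (p.app X)))
    (hα : ∀ X, IsIso (α.app (R.obj X))) {G : D ⥤ H} (β : Q ⋙ G ⟶ F) : Q ⋙ G ⟶ Q ⋙ LF where
  app X := G.map (CategoryTheory.inv (Q.map (p.app X))) ≫ β.app (R.obj X) ≫
    CategoryTheory.inv (α.app (R.obj X)) ≫ LF.map (Q.map (p.app X))
  naturality X Y f := by
    have h₁ : CategoryTheory.inv (Q.map (p.app X)) ≫ Q.map (R.map f) =
        Q.map f ≫ CategoryTheory.inv (Q.map (p.app Y)) := by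
      rw [IsIso.inv_comp_eq, ← Category.assoc, IsIso.eq_comp_inv, ← Q.map_comp, ← Q.map_comp]
      exact congrArg _ (p.naturality f)
    have h₂ : Q.map (R.map f) ≫ Q.map (p.app Y) = Q.map (p.app X) ≫ Q.map f := by
      rw [← Q.map_comp, ← Q.map_comp]
      exact congrArg _ (p.naturality f)
    have h₃ : LF.map (Q.map (R.map f)) ≫ α.app (R.obj Y) = α.app (R.obj X) ≫ F.map (R.map f) :=
      α.naturality (R.map f)
    have h₄ : G.map (Q.map (R.map f)) ≫ β.app (R.obj Y) = β.app (R.obj X) ≫ F.map (R.map f) :=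
      β.naturality (R.map f)
    have h₅ : CategoryTheory.inv (α.app (R.obj X)) ≫ LF.map (Q.map (R.map f)) =
        F.map (R.map f) ≫ CategoryTheory.inv (α.app (R.obj Y)) := by
      rw [IsIso.inv_comp_eq, ← Category.assoc, IsIso.eq_comp_inv]
      exact h₃
    simp only [comp_map, Category.assoc]
    rw [← LF.map_comp, ← h₂, LF.map_comp, reassoc_of% h₅, ← reassoc_of% h₄, ← G.map_comp_assoc,
      ← h₁, G.map_comp_assoc]

lemma resolutionLift_comp (hp : ∀ X, IsIso (Q.map (p.app X)))
    (hα : ∀ X, IsIso (α.app (R.obj X))) {G : D ⥤ H} (β : Q ⋙ G ⟶ F) :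
    resolutionLift α p hp hα β ≫ α = β := by
  ext X
  have h₁ : LF.map (Q.map (p.app X)) ≫ α.app X = α.app (R.obj X) ≫ F.map (p.app X) :=
    α.naturality (p.app X)
  have h₂ : G.map (Q.map (p.app X)) ≫ β.app X = β.app (R.obj X) ≫ F.map (p.app X) :=
    β.naturality (p.app X)
  simp only [NatTrans.comp_app, resolutionLift, Category.assoc]
  rw [h₁, IsIso.inv_hom_id_assoc, ← h₂, ← G.map_comp_assoc, IsIso.inv_hom_id, G.map_id,
    Category.id_comp]

/-- Uniqueness of the lift: a transformation into `LF` is recovered from its composite with `α`. -/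
lemma resolutionLift_whiskerLeft_comp (hp : ∀ X, IsIso (Q.map (p.app X)))
    (hα : ∀ X, IsIso (α.app (R.obj X))) {G : D ⥤ H} (γ : G ⟶ LF) :
    resolutionLift α p hp hα (whiskerLeft Q γ ≫ α) = whiskerLeft Q γ := by
  ext X
  simp only [resolutionLift, NatTrans.comp_app, whiskerLeft_app, Category.assoc,
    IsIso.hom_inv_id_assoc]
  rw [← γ.naturality, ← G.map_comp_assoc, IsIso.inv_hom_id, G.map_id, Category.id_comp]

/-- A functor `LF` with a comparison transformation `α : Q ⋙ LF ⟶ F` is a left derived functor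
of `F` if there is a functorial resolution by objects at which `α` is an isomorphism. -/
lemma isLeftDerivedFunctor_of_resolution (hp : ∀ X, IsIso (Q.map (p.app X)))
    (hα : ∀ X, IsIso (α.app (R.obj X))) : LF.IsLeftDerivedFunctor α W := by
  rw [isLeftDerivedFunctor_iff_isRightKanExtension]
  let lift {G : D ⥤ H} (β : Q ⋙ G ⟶ F) : G ⟶ LF :=
    Localization.liftNatTrans Q W (Q ⋙ G) (Q ⋙ LF) G LF (resolutionLift α p hp hα β)
  have lift_fac {G : D ⥤ H} (β : Q ⋙ G ⟶ F) :
      whiskerLeft Q (lift β) = resolutionLift α p hp hα β := by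
    ext X
    simp [lift]
  refine ⟨⟨IsTerminal.ofUniqueHom (fun G ↦ CostructuredArrow.homMk (lift G.hom) ?_)
    fun G m ↦ ?_⟩⟩
  · exact (congrArg (· ≫ α) (lift_fac G.hom)).trans (resolutionLift_comp α p hp hα G.hom)
  · refine CostructuredArrow.hom_ext _ _ (Localization.natTrans_ext Q W fun X ↦ ?_)
    let m' : G.left ⟶ LF := m.left
    have h : whiskerLeft Q m' ≫ α = G.hom := CostructuredArrow.w m
    have h' : whiskerLeft Q m' = whiskerLeft Q (lift G.hom) := by
      refine (resolutionLift_whiskerLeft_comp α p hp hα m').symm.trans ?_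
      rw [h, lift_fac]
    exact NatTrans.congr_app h' X

end Functor

end CategoryTheory

/-! ### Functorial two-term resolutions of complexes -/

namespace CochainComplex

section

variable {C : Type*} [Category* C] [Abelian C] {Φ : C ⥤ C} [Φ.PreservesZeroMorphisms]
  (π : Φ ⟶ 𝟭 C)

/-- The augmentation of the functor on complexes induced by an augmented functor. -/
noncomputable def complexAugmentation :
    Φ.mapHomologicalComplex (ComplexShape.up ℤ) ⟶ 𝟭 (CochainComplex C ℤ) :=
  NatTrans.mapHomologicalComplex π (ComplexShape.up ℤ) ≫
    (Functor.mapHomologicalComplexIdIso C (ComplexShape.up ℤ)).hom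

lemma complexAugmentation_app_f (K : CochainComplex C ℤ) (n : ℤ) :
    ((complexAugmentation π).app K).f n = π.app (K.X n) :=
  Category.comp_id _

/-- The two term resolution `0 ⟶ Ker π ⟶ Φ ⟶ 𝟭 ⟶ 0` given by an augmented functor. -/
noncomputable def resolutionShortComplex :
    CochainComplex C ℤ ⥤ ShortComplex (CochainComplex C ℤ) where
  obj K := ShortComplex.mk (kernel.ι ((complexAugmentation π).app K))
    ((complexAugmentation π).app K) (kernel.condition _)
  map {K L} f :=
    { τ₁ := kernel.map _ _ ((Φ.mapHomologicalComplex (ComplexShape.up ℤ)).map f) f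
        ((complexAugmentation π).naturality f).symm
      τ₂ := (Φ.mapHomologicalComplex (ComplexShape.up ℤ)).map f
      τ₃ := f
      comm₁₂ := kernel.lift_ι _ _ _
      comm₂₃ := (complexAugmentation π).naturality f }
  map_id K := by
    ext : 1
    · rw [← cancel_mono (kernel.ι _)]
      exact (kernel.lift_ι _ _ _).trans (by simp)
    · exact (Φ.mapHomologicalComplex (ComplexShape.up ℤ)).map_id K
    · rfl
  map_comp f g := by
    ext : 1
    · rw [← cancel_mono (kernel.ι _)]
      exact (kernel.lift_ι _ _ _).trans (by simp)
    · exact (Φ.mapHomologicalComplex (ComplexShape.up ℤ)).map_comp f g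
    · rfl

lemma shortExact_resolutionShortComplex (hπ : ∀ X, Epi (π.app X)) (K : CochainComplex C ℤ) :
    ((resolutionShortComplex π).obj K).ShortExact := by
  have : Epi ((complexAugmentation π).app K) := by
    have (n : ℤ) : Epi (((complexAugmentation π).app K).f n) := by
      rw [complexAugmentation_app_f]; exact hπ _
    exact HomologicalComplex.epi_of_epi_f _ this
  exact { exact := ShortComplex.exact_kernel _
          mono_f := (inferInstance : Mono (kernel.ι ((complexAugmentation π).app K)))
          epi_g := this }

/-- The resolution functor given by an augmented functor. -/
noncomputable def resolutionFunctor : CochainComplex C ℤ ⥤ CochainComplex C ℤ where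
  obj K := mappingCone ((resolutionShortComplex π).obj K).f
  map f := mappingCone.map _ _ ((resolutionShortComplex π).map f).τ₁
    ((resolutionShortComplex π).map f).τ₂ ((resolutionShortComplex π).map f).comm₁₂.symm
  map_id K := by
    refine Eq.trans ?_ (mappingCone.map_id ((resolutionShortComplex π).obj K).f)
    congr 1 <;> simp
  map_comp f g := by
    refine Eq.trans ?_ (mappingCone.map_comp _ _ _ _ _
      ((resolutionShortComplex π).map f).comm₁₂.symm _ _
      ((resolutionShortComplex π).map g).comm₁₂.symm)
    congr 1 <;> simp

/-- The augmentation of the resolution functor. -/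
noncomputable def resolutionAugmentation : resolutionFunctor π ⟶ 𝟭 (CochainComplex C ℤ) where
  app K := mappingCone.descShortComplex ((resolutionShortComplex π).obj K)
  naturality _ _ f := mappingCone.map_descShortComplex _ _ ((resolutionShortComplex π).map f)

lemma quasiIso_resolutionAugmentation_app (hπ : ∀ X, Epi (π.app X)) (K : CochainComplex C ℤ) :
    QuasiIso ((resolutionAugmentation π).app K) :=
  mappingCone.quasiIso_descShortComplex (shortExact_resolutionShortComplex π hπ K)

/-- The terms of the kernel of the augmentation. -/
noncomputable def resolutionShortComplexX₁XIso (K : CochainComplex C ℤ) (n : ℤ) :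
    ((resolutionShortComplex π).obj K).X₁.X n ≅ kernel (π.app (K.X n)) :=
  PreservesKernel.iso (HomologicalComplex.eval C _ n) ((complexAugmentation π).app K) ≪≫
    kernelIsoOfEq (complexAugmentation_app_f π K n)

/-- The terms of the resolution of a complex. -/
noncomputable def resolutionFunctorXIso (K : CochainComplex C ℤ) (n : ℤ) :
    ((resolutionFunctor π).obj K).X n ≅ kernel (π.app (K.X (n + 1))) ⊞ Φ.obj (K.X n) :=
  HomologicalComplex.homotopyCofiber.XIsoBiprod ((resolutionShortComplex π).obj K).f n (n + 1) rfl
    ≪≫ biprod.mapIso (resolutionShortComplexX₁XIso π K (n + 1)) (Iso.refl _)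

end

end CochainComplex

/-! ### Torsion-free resolutions of modules -/

namespace ModuleCat

variable (A : Type u) [CommRing A]

/-- The submodule of the free module on the elements of `M` which consists of the
elements of degree zero. -/
noncomputable abbrev degreeZero (M : Type u) : Submodule A (M →₀ A) :=
  LinearMap.ker (Finsupp.linearCombination A (fun _ : M ↦ (1 : A)))

lemma mapDomain_mem_degreeZero {M N : Type u} (f : M → N) (x : M →₀ A)
    (hx : x ∈ degreeZero A M) : Finsupp.lmapDomain A A f x ∈ degreeZero A N := by
  rw [LinearMap.mem_ker] at hx ⊢
  exact (Finsupp.linearCombination_mapDomain A f x).trans hx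

/-- The functor which sends a module `M` to the degree zero part of the free module on `M`. -/
noncomputable def degreeZeroFunctor : ModuleCat.{u} A ⥤ ModuleCat.{u} A where
  obj M := ModuleCat.of A (degreeZero A M)
  map {M N} f := ModuleCat.ofHom ((Finsupp.lmapDomain A A f).restrict
    (mapDomain_mem_degreeZero A f))
  map_id M := by
    ext x : 3
    simp
  map_comp f g := by
    ext x : 2
    exact Subtype.ext (Finsupp.mapDomain_comp (v := x.1) (f := f.hom) (g := g.hom))

/-- The zero map collapses `x` to its coefficient sum placed at `0`, which is zero in degree zero.
The full free module functor lacks this property, which is needed to apply a functor termwise to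
complexes. -/
instance : (degreeZeroFunctor A).PreservesZeroMorphisms where
  map_zero M N := by
    ext ⟨x, hx⟩ : 3
    refine Subtype.ext ?_
    change Finsupp.mapDomain (fun _ ↦ (0 : N)) x = 0
    have h : (x.sum fun _ a ↦ a) = 0 := by
      simpa [Finsupp.linearCombination_apply] using hx
    rw [Finsupp.mapDomain]
    exact (Finsupp.single_sum x (fun _ a ↦ a) (0 : N)).symm.trans
      (by rw [h, Finsupp.single_zero])

/-- The augmentation of the degree zero part of the free module on `M`. -/
noncomputable def degreeZeroAugmentation : degreeZeroFunctor A ⟶ 𝟭 (ModuleCat.{u} A) where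
  app M := ModuleCat.ofHom ((Finsupp.linearCombination A (id : M → M)).comp
    (degreeZero A M).subtype)
  naturality M N f := by
    ext x : 3
    exact (Finsupp.linearCombination_mapDomain A f.hom x.1).trans
      (Finsupp.apply_linearCombination A f.hom id x.1).symm

lemma epi_degreeZeroAugmentation_app (M : ModuleCat.{u} A) :
    Epi ((degreeZeroAugmentation A).app M) := by
  rw [ModuleCat.epi_iff_surjective]
  intro m
  -- Subtracting the basis vector at `0` makes the coefficient sum zero without changing the image
  -- `m`.
  refine ⟨⟨Finsupp.single m 1 - Finsupp.single 0 1, ?_⟩, ?_⟩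
  · simp [LinearMap.mem_ker]
  · change Finsupp.linearCombination A id _ = m
    simp

lemma isTorsionFree_of_mono {M N : ModuleCat.{u} A} (f : M ⟶ N) [Mono f]
    [Module.IsTorsionFree A N] : Module.IsTorsionFree A M :=
  Function.Injective.moduleIsTorsionFree _ ((ModuleCat.mono_iff_injective f).1 inferInstance)
    (fun a x ↦ f.hom.map_smul a x)

instance (M : ModuleCat.{u} A) :
    Module.IsTorsionFree A ((degreeZeroFunctor A).obj M) :=
  inferInstanceAs (Module.IsTorsionFree A (degreeZero A M))

lemma isTorsionFree_resolution (K : CochainComplex (ModuleCat.{u} A) ℤ) (n : ℤ) :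
    Module.IsTorsionFree A
      (((CochainComplex.resolutionFunctor (degreeZeroAugmentation A)).obj K).X n) := by
  have := isTorsionFree_of_mono A (kernel.ι ((degreeZeroAugmentation A).app (K.X (n + 1))))
  have : Module.IsTorsionFree A (ModuleCat.of A
    ((kernel ((degreeZeroAugmentation A).app (K.X (n + 1))) : ModuleCat.{u} A) ×
      (degreeZeroFunctor A).obj (K.X n))) :=
    inferInstanceAs (Module.IsTorsionFree A (_ × _))
  exact isTorsionFree_of_mono A
    (CochainComplex.resolutionFunctorXIso (degreeZeroAugmentation A) K n ≪≫
      ModuleCat.biprodIsoProd _ _).hom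

end ModuleCat

/-! ### Idempotent augmentations on the derived category -/

namespace CochainComplex

variable {C : Type*} [Category* C] [Abelian C] {G : C ⥤ C} [G.PreservesZeroMorphisms]
  (σ : 𝟭 C ⟶ G)

/-- The coaugmentation of the functor on complexes induced by a coaugmented functor. -/
noncomputable def complexCoaugmentation :
    𝟭 (CochainComplex C ℤ) ⟶ G.mapHomologicalComplex (ComplexShape.up ℤ) :=
  (Functor.mapHomologicalComplexIdIso C (ComplexShape.up ℤ)).inv ≫
    NatTrans.mapHomologicalComplex σ (ComplexShape.up ℤ)

lemma complexCoaugmentation_app_f (K : CochainComplex C ℤ) (n : ℤ) :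
    ((complexCoaugmentation σ).app K).f n = σ.app (K.X n) :=
  Category.id_comp _

end CochainComplex

namespace CategoryTheory

namespace IdempotentAugmentation

open Pretriangulated _root_.DerivedCategory

variable {C : Type*} [Category* C] [Abelian C] {F : C ⥤ C}
  (B : IdempotentAugmentation F)

section

variable [F.PreservesZeroMorphisms]

lemma isIso_map_complexAugmentation_app (K : CochainComplex C ℤ) :
    IsIso ((F.mapHomologicalComplex (ComplexShape.up ℤ)).map
      ((CochainComplex.complexAugmentation B.ε).app K)) := by
  have (n : ℤ) : IsIso (((F.mapHomologicalComplex (ComplexShape.up ℤ)).map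
      ((CochainComplex.complexAugmentation B.ε).app K)).f n) := by
    change IsIso (F.map (((CochainComplex.complexAugmentation B.ε).app K).f n))
    rw [CochainComplex.complexAugmentation_app_f]
    exact B.isIso_map_app _
  exact HomologicalComplex.Hom.isIso_of_components _

lemma isIso_complexAugmentation_app_obj (K : CochainComplex C ℤ) :
    IsIso ((CochainComplex.complexAugmentation B.ε).app
      ((F.mapHomologicalComplex (ComplexShape.up ℤ)).obj K)) := by
  have (n : ℤ) : IsIso (((CochainComplex.complexAugmentation B.ε).app
      ((F.mapHomologicalComplex (ComplexShape.up ℤ)).obj K)).f n) := by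
    rw [CochainComplex.complexAugmentation_app_f]
    exact B.isIso_app_obj _
  exact HomologicalComplex.Hom.isIso_of_components _

end

variable [HasDerivedCategory.{w} C] [F.Additive] [PreservesFiniteLimits F] [PreservesFiniteColimits F]

/-- The augmentation of the functor on the derived category which is induced by an
augmented exact functor. -/
noncomputable def derivedAugmentation : F.mapDerivedCategory ⟶ 𝟭 (DerivedCategory C) :=
  Localization.liftNatTrans Q (HomologicalComplex.quasiIso C (ComplexShape.up ℤ))
    (F.mapHomologicalComplex (ComplexShape.up ℤ) ⋙ Q) Q _ _
    (Functor.whiskerRight (CochainComplex.complexAugmentation B.ε) Q ≫ Q.leftUnitor.hom)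

lemma derivedAugmentation_app_Q_obj (K : CochainComplex C ℤ) :
    B.derivedAugmentation.app (Q.obj K) = F.mapDerivedCategoryFactors.hom.app K ≫
      Q.map ((CochainComplex.complexAugmentation B.ε).app K) := by
  refine (Localization.liftNatTrans_app _ _ _ _ _ _ _ K).trans ?_
  simp
  rfl

lemma isIso_derivedAugmentation_app_Q_obj_iff (K : CochainComplex C ℤ) :
    IsIso (B.derivedAugmentation.app (Q.obj K)) ↔
      QuasiIso ((CochainComplex.complexAugmentation B.ε).app K) := by
  rw [derivedAugmentation_app_Q_obj, ← isIso_Q_map_iff_quasiIso]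
  exact isIso_comp_left_iff _ _

/-- The idempotent augmentation on the derived category induced by an idempotent augmentation
of an exact functor. -/
noncomputable def mapDerivedCategory : IdempotentAugmentation F.mapDerivedCategory where
  ε := B.derivedAugmentation
  isIso_map_app X := by
    have := B.isIso_map_complexAugmentation_app (Q.objPreimage X)
    refine (NatTrans.isIso_app_iff_of_iso (Functor.whiskerRight B.derivedAugmentation _)
      (Q.objObjPreimageIso X)).1 ?_
    change IsIso (F.mapDerivedCategory.map (B.derivedAugmentation.app _))
    rw [derivedAugmentation_app_Q_obj, Functor.map_comp]
    have : IsIso (F.mapDerivedCategory.map (Q.map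
        ((CochainComplex.complexAugmentation B.ε).app (Q.objPreimage X)))) :=
      (NatIso.isIso_map_iff F.mapDerivedCategoryFactors _).2
        (inferInstanceAs (IsIso (Q.map ((F.mapHomologicalComplex (ComplexShape.up ℤ)).map
          ((CochainComplex.complexAugmentation B.ε).app (Q.objPreimage X))))))
    exact IsIso.comp_isIso' inferInstance this
  isIso_app_obj X := by
    have := B.isIso_complexAugmentation_app_obj (Q.objPreimage X)
    refine (NatTrans.isIso_app_iff_of_iso B.derivedAugmentation
      ((F.mapDerivedCategoryFactors.app (Q.objPreimage X)).symm ≪≫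
        F.mapDerivedCategory.mapIso (Q.objObjPreimageIso X))).1 ?_
    refine (B.isIso_derivedAugmentation_app_Q_obj_iff _).2 ?_
    exact inferInstance

lemma kernelProperty_Q_obj_iff (K : CochainComplex C ℤ) :
    F.mapDerivedCategory.kernelProperty (Q.obj K) ↔
      ((F.mapHomologicalComplex (ComplexShape.up ℤ)).obj K).Acyclic := by
  rw [← isZero_Q_obj_iff]
  exact (F.mapDerivedCategoryFactors.app K).isZero_iff

variable (F) in
lemma isClosedUnderColimitsOfShape_kernelProperty_mapDerivedCategory (J : Type*)
    [HasColimitsOfShape (Discrete J) C] [HasExactColimitsOfShape (Discrete J) C]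
    [PreservesColimitsOfShape (Discrete J) F] :
    F.mapDerivedCategory.kernelProperty.IsClosedUnderColimitsOfShape (Discrete J) := by
  refine isClosedUnderColimitsOfShape_discrete_of_sigma _ fun K hK ↦ ?_
  rw [kernelProperty_Q_obj_iff, ← isZero_Q_obj_iff]
  refine IsZero.of_iso ?_ (Q.mapIso
    (PreservesCoproduct.iso (F.mapHomologicalComplex (ComplexShape.up ℤ)) K))
  rw [isZero_Q_obj_iff]
  exact acyclic_sigma _ fun j ↦ (kernelProperty_Q_obj_iff _).1 (hK j)

variable {G : C ⥤ C} [G.PreservesZeroMorphisms] (σ : 𝟭 C ⟶ G)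

lemma kernelProperty_Q_obj_of_isZero (hFG : ∀ X, IsZero (F.obj (G.obj X)))
    (K : CochainComplex C ℤ) : F.mapDerivedCategory.kernelProperty
      (Q.obj ((G.mapHomologicalComplex (ComplexShape.up ℤ)).obj K)) := by
  rw [kernelProperty_Q_obj_iff]
  intro n
  exact ShortComplex.exact_of_isZero_X₂ _ (hFG (K.X n))

/-- The comparison of the localization functor with the functor `G`, which takes values in
the kernel. -/
noncomputable def comparison (hFG : ∀ X, IsZero (F.obj (G.obj X))) :
    Q ⋙ B.mapDerivedCategory.localization ⟶ G.mapHomologicalComplex (ComplexShape.up ℤ) ⋙ Q where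
  app K := ((B.mapDerivedCategory.bijective_unit_precomp (Q.obj K)
    (kernelProperty_Q_obj_of_isZero hFG K)).2
      (Q.map ((CochainComplex.complexCoaugmentation σ).app K))).choose
  naturality K K' f := by
    refine (B.mapDerivedCategory.bijective_unit_precomp (Q.obj K)
      (kernelProperty_Q_obj_of_isZero hFG K')).1 ?_
    have h (K : CochainComplex C ℤ) := ((B.mapDerivedCategory.bijective_unit_precomp (Q.obj K)
      (kernelProperty_Q_obj_of_isZero hFG K)).2
      (Q.map ((CochainComplex.complexCoaugmentation σ).app K))).choose_spec
    have h₁ := B.mapDerivedCategory.unit.naturality (Q.map f)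
    have h₂ := (CochainComplex.complexCoaugmentation σ).naturality f
    dsimp only at h ⊢
    dsimp at h₁ h₂ ⊢
    rw [← reassoc_of% h₁, h, reassoc_of% (h K), ← Q.map_comp, ← Q.map_comp, h₂]

lemma unit_comparison (hFG : ∀ X, IsZero (F.obj (G.obj X))) (K : CochainComplex C ℤ) :
    B.mapDerivedCategory.unit.app (Q.obj K) ≫ (B.comparison σ hFG).app K =
      Q.map ((CochainComplex.complexCoaugmentation σ).app K) :=
  ((B.mapDerivedCategory.bijective_unit_precomp (Q.obj K)
    (kernelProperty_Q_obj_of_isZero hFG K)).2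
      (Q.map ((CochainComplex.complexCoaugmentation σ).app K))).choose_spec

/-- The degreewise short exact sequences give a triangle on `F K ⟶ K ⟶ G K`, to be compared with the
triangle of the unit. -/
lemma isIso_comparison_app (hFG : ∀ X, IsZero (F.obj (G.obj X))) (K : CochainComplex C ℤ)
    (zero : ∀ X, B.ε.app X ≫ σ.app X = 0)
    (hK : ∀ n, (ShortComplex.mk _ _ (zero (K.X n))).ShortExact) :
    IsIso ((B.comparison σ hFG).app K) := by
  let S : ShortComplex (CochainComplex C ℤ) :=
    ShortComplex.mk ((CochainComplex.complexAugmentation B.ε).app K)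
      ((CochainComplex.complexCoaugmentation σ).app K) (by
        ext n
        rw [HomologicalComplex.comp_f, CochainComplex.complexAugmentation_app_f,
          CochainComplex.complexCoaugmentation_app_f]
        exact zero _)
  have hS : S.ShortExact := by
    refine HomologicalComplex.shortExact_of_degreewise_shortExact _ fun n ↦ ?_
    refine ShortComplex.shortExact_of_iso (ShortComplex.isoMk (S₁ := ShortComplex.mk _ _ (zero (K.X n)))
      (S₂ := S.map (HomologicalComplex.eval C (ComplexShape.up ℤ) n)) (Iso.refl _) (Iso.refl _)
      (Iso.refl _) ?_ ?_) (hK n)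
    · refine (Category.id_comp _).trans (Eq.trans ?_ (Category.comp_id _).symm)
      exact CochainComplex.complexAugmentation_app_f B.ε K n
    · refine (Category.id_comp _).trans (Eq.trans ?_ (Category.comp_id _).symm)
      exact CochainComplex.complexCoaugmentation_app_f σ K n
  obtain ⟨δ, hδ⟩ := B.mapDerivedCategory.unit_distinguished (Q.obj K)
  obtain ⟨c, hc, hc'⟩ := complete_distinguished_triangle_morphism _ _ hδ
    (triangleOfSES_distinguished hS) (F.mapDerivedCategoryFactors.hom.app K) (𝟙 _)
    ((Category.comp_id _).trans (B.derivedAugmentation_app_Q_obj K))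
  let f : Triangle.mk _ _ δ ⟶ triangleOfSES hS := Triangle.homMk _ _
    (F.mapDerivedCategoryFactors.hom.app K) (𝟙 _) c
    ((Category.comp_id _).trans (B.derivedAugmentation_app_Q_obj K)) hc hc'
  have : IsIso c := isIso₃_of_isIso₁₂ f hδ (triangleOfSES_distinguished hS)
    (inferInstanceAs (IsIso (F.mapDerivedCategoryFactors.hom.app K)))
    (inferInstanceAs (IsIso (𝟙 (Q.obj K))))
  -- A map of cones is not canonical in general; here it is determined by its composite with the
  -- unit, as `G K` lies in the kernel.
  have : (B.comparison σ hFG).app K = c :=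
    (B.mapDerivedCategory.bijective_unit_precomp (Q.obj K)
      (kernelProperty_Q_obj_of_isZero hFG K)).1
      ((B.unit_comparison σ hFG K).trans ((Category.id_comp _).symm.trans hc.symm))
  rw [this]
  assumption

end IdempotentAugmentation

end CategoryTheory

/-! ### Flatness and idempotence over valuation rings -/

section ValuationRing

variable {A : Type u} [CommRing A] [IsDomain A] [ValuationRing A]

lemma ValuationRing.flat_of_isTorsionFree (M : Type*) [AddCommGroup M] [Module A M]
    [Module.IsTorsionFree A M] : Module.Flat A M :=
  Module.Flat.flat_iff_torsion_eq_bot_of_isBezout.2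
    (Submodule.isTorsionFree_iff_torsion_eq_bot.1 inferInstance)

lemma ValuationRing.isIdempotentElem_maximalIdeal
    (hP : ¬ (IsLocalRing.maximalIdeal A).IsPrincipal) :
    IsIdempotentElem (IsLocalRing.maximalIdeal A) := by
  refine le_antisymm Ideal.mul_le_left fun x hx ↦ ?_
  -- Such a `y` exists since `x` does not generate the ideal. Then `x = y * c`, and `c` is a
  -- nonunit, as otherwise `x` would divide `y`.
  obtain ⟨y, hy, hxy⟩ : ∃ y ∈ IsLocalRing.maximalIdeal A, ¬ x ∣ y := by
    by_contra! h
    exact hP ⟨x, le_antisymm (fun y hy ↦ Ideal.mem_span_singleton.2 (h y hy))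
      ((Ideal.span_singleton_le_iff_mem _).2 hx)⟩
  obtain ⟨c, rfl⟩ := (ValuationRing.dvd_total x y).resolve_left hxy
  refine Ideal.mul_mem_mul hy ?_
  by_contra hc
  rw [IsLocalRing.mem_maximalIdeal, mem_nonunits_iff, not_not] at hc
  exact hxy (hc.mul_right_dvd.2 dvd_rfl)

end ValuationRing

/-! ### Tensoring with a flat idempotent ideal -/

namespace Ideal

open TensorProduct

variable {A : Type u} [CommRing A] (I : Ideal A)

/-- The multiplication map `M ⊗ I → M`. -/
noncomputable def tensorMul (M : Type*) [AddCommGroup M] [Module A M] : M ⊗[A] I →ₗ[A] M :=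
  (TensorProduct.rid A M).toLinearMap ∘ₗ I.subtype.lTensor M

@[simp]
lemma tensorMul_tmul {M : Type*} [AddCommGroup M] [Module A M] (m : M) (a : I) :
    I.tensorMul M (m ⊗ₜ a) = (a : A) • m := rfl

lemma range_tensorMul (M : Type*) [AddCommGroup M] [Module A M] :
    LinearMap.range (I.tensorMul M) = I • (⊤ : Submodule A M) := by
  refine le_antisymm ?_ (Submodule.smul_le.2 fun a ha m _ ↦ ⟨m ⊗ₜ ⟨a, ha⟩, rfl⟩)
  rw [LinearMap.range_eq_map, ← TensorProduct.span_tmul_eq_top, Submodule.map_span_le]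
  rintro _ ⟨m, a, rfl⟩
  exact Submodule.smul_mem_smul a.2 trivial

lemma tensorMul_injective (M : Type*) [AddCommGroup M] [Module A M] [Module.Flat A M] :
    Function.Injective (I.tensorMul M) :=
  (TensorProduct.rid A M).injective.comp
    (Module.Flat.lTensor_preserves_injective_linearMap _ I.injective_subtype)

variable {I}

/-- Flatness gives injectivity; the image is `I * I = I`. -/
lemma tensorMul_self_bijective [Module.Flat A I] (hI : IsIdempotentElem I) :
    Function.Bijective (I.tensorMul I) := by
  refine ⟨I.tensorMul_injective I, LinearMap.range_eq_top.1 ?_⟩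
  rw [range_tensorMul]
  refine Submodule.map_injective_of_injective I.injective_subtype ?_
  rw [Submodule.map_smul'', Submodule.map_top, Submodule.range_subtype]
  exact hI

lemma rTensor_tensorMul (M : Type*) [AddCommGroup M] [Module A M] :
    (I.tensorMul M).rTensor I = I.tensorMul (M ⊗[A] I) := by
  ext m a b
  simp only [AlgebraTensorModule.curry_apply, LinearMap.restrictScalars_self, curry_apply,
    LinearMap.rTensor_tmul, tensorMul_tmul, smul_tmul', smul_tmul]
  congr 1
  exact Subtype.ext (mul_comm _ _)

/-- Up to associativity the map is `M` tensored with the isomorphism `I ⊗ I ≅ I`, so `M` may be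
arbitrary. -/
lemma rTensor_tensorMul_bijective [Module.Flat A I] (hI : IsIdempotentElem I)
    (M : Type*) [AddCommGroup M] [Module A M] :
    Function.Bijective ((I.tensorMul M).rTensor I) := by
  have h : (I.tensorMul M).rTensor I = (I.tensorMul I).lTensor M ∘ₗ
      (TensorProduct.assoc A M I I).toLinearMap := by
    ext m a b
    simp only [AlgebraTensorModule.curry_apply, LinearMap.restrictScalars_self, curry_apply,
      LinearMap.rTensor_tmul, tensorMul_tmul, smul_tmul, LinearMap.comp_apply,
      LinearEquiv.coe_coe, assoc_tmul, LinearMap.lTensor_tmul]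
    congr 1
    exact Subtype.ext (mul_comm _ _)
  rw [h]
  exact (LinearEquiv.lTensor M (LinearEquiv.ofBijective _
    (tensorMul_self_bijective hI))).bijective.comp (TensorProduct.assoc A M I I).bijective

end Ideal

namespace ModuleCat

open MonoidalCategory

variable {A : Type u} [CommRing A] (I : Ideal A)

/-- The multiplication maps `M ⊗ I ⟶ M`. -/
noncomputable def tensorIdealAugmentation :
    tensorRight (ModuleCat.of A I) ⟶ 𝟭 (ModuleCat.{u} A) where
  app M := ModuleCat.ofHom (I.tensorMul M)
  naturality M N f := by
    refine ModuleCat.hom_ext (TensorProduct.ext' fun m a ↦ ?_)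
    exact (map_smul f.hom (a : A) m).symm

/-- The canonical maps `M ⟶ M ⊗ A/I`. -/
noncomputable def tensorQuotientCoaugmentation :
    𝟭 (ModuleCat.{u} A) ⟶ tensorRight (ModuleCat.of A (A ⧸ I)) where
  app M := ModuleCat.ofHom (I.mkQ.lTensor M ∘ₗ (TensorProduct.rid A M).symm.toLinearMap)
  naturality _ _ _ := rfl

lemma tensorIdealAugmentation_comp_tensorQuotientCoaugmentation (M : ModuleCat.{u} A) :
    (tensorIdealAugmentation I).app M ≫ (tensorQuotientCoaugmentation I).app M = 0 := by
  refine ModuleCat.hom_ext (TensorProduct.ext' fun m a ↦ ?_)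
  change ((a : A) • m) ⊗ₜ[A] (Submodule.Quotient.mk (p := I) (1 : A)) = 0
  rw [TensorProduct.smul_tmul, ← Submodule.Quotient.mk_smul,
    (Submodule.Quotient.mk_eq_zero I).2 (by simp), TensorProduct.tmul_zero]

lemma shortExact_tensorIdeal (M : ModuleCat.{u} A) [Module.Flat A M] :
    (ShortComplex.mk _ _
      (tensorIdealAugmentation_comp_tensorQuotientCoaugmentation I M)).ShortExact := by
  refine ShortComplex.ShortExact.mk' ?_ ?_ ?_
  · rw [ShortComplex.ShortExact.moduleCat_exact_iff_function_exact]
    have h := lTensor_exact M (LinearMap.exact_subtype_mkQ I) I.mkQ_surjective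
    intro x
    refine (h ((TensorProduct.rid A M).symm x)).trans (exists_congr fun y ↦ ?_)
    exact (TensorProduct.rid A M).eq_symm_apply
  · rw [ModuleCat.mono_iff_injective]
    exact I.tensorMul_injective M
  · rw [ModuleCat.epi_iff_surjective]
    exact (LinearMap.lTensor_surjective M I.mkQ_surjective).comp
      (TensorProduct.rid A M).symm.surjective

lemma tensorIdealAugmentation_app_tensorQuotient (M : ModuleCat.{u} A) :
    (tensorIdealAugmentation I).app ((tensorRight (ModuleCat.of A (A ⧸ I))).obj M) = 0 := by
  refine ModuleCat.hom_ext (TensorProduct.ext' fun m a ↦ ?_)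
  change (a : A) • m = 0
  induction m using TensorProduct.induction_on with
  | zero => exact smul_zero _
  | tmul m b =>
    obtain ⟨b, rfl⟩ := Submodule.Quotient.mk_surjective _ b
    rw [← TensorProduct.tmul_smul, ← Submodule.Quotient.mk_smul,
      (Submodule.Quotient.mk_eq_zero I).2 (show (a : A) • b ∈ I from I.mul_mem_right b a.2),
      TensorProduct.tmul_zero]
  | add x y hx hy => rw [smul_add, hx, hy, add_zero]

variable {I} [Module.Flat A I] (hI : IsIdempotentElem I)

/-- The idempotent augmentation of the functor `- ⊗ I` for a flat idempotent ideal `I`. -/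
noncomputable def tensorIdealIdempotentAugmentation :
    IdempotentAugmentation (tensorRight (ModuleCat.of A I)) where
  ε := tensorIdealAugmentation I
  isIso_map_app M := by
    rw [ConcreteCategory.isIso_iff_bijective]
    exact I.rTensor_tensorMul_bijective hI M
  isIso_app_obj M := by
    rw [ConcreteCategory.isIso_iff_bijective]
    have := I.rTensor_tensorMul_bijective hI M
    rw [Ideal.rTensor_tensorMul] at this
    exact this

-- The augmentation at `M ⊗ A/I` is zero, because `I` kills this module, yet it becomes invertible
-- after tensoring with `I`.
include hI in
lemma isZero_tensorIdeal_tensorQuotient (M : ModuleCat.{u} A) :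
    IsZero ((tensorRight (ModuleCat.of A I)).obj
      ((tensorRight (ModuleCat.of A (A ⧸ I))).obj M)) := by
  have := (tensorIdealIdempotentAugmentation hI).isIso_map_app
    ((tensorRight (ModuleCat.of A (A ⧸ I))).obj M)
  have h : (tensorIdealIdempotentAugmentation hI).ε.app
    ((tensorRight (ModuleCat.of A (A ⧸ I))).obj M) = 0 :=
      tensorIdealAugmentation_app_tensorQuotient I M
  rw [h, Functor.map_zero] at this
  exact (IsZero.iff_id_eq_zero _).2 ((IsIso.inv_hom_id (0 : (tensorRight (ModuleCat.of A I)).obj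
    ((tensorRight (ModuleCat.of A I)).obj
      ((tensorRight (ModuleCat.of A (A ⧸ I))).obj M)) ⟶ _)).symm.trans comp_zero)

end ModuleCat

/-! ### Nakayama's lemma and perfect complexes -/

section LinearAlgebra

variable {A : Type u} [CommRing A] [IsDomain A] [ValuationRing A]
  {M N : Type*} [AddCommGroup M] [Module A M] [AddCommGroup N] [Module A N]

/-- Over a valuation ring, the kernel of a linear map from a finite module to a torsion-free
module is a direct summand. -/
lemma ValuationRing.exists_projection_ker [Module.Finite A M] [Module.IsTorsionFree A N]
    (f : M →ₗ[A] N) :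
    ∃ r : M →ₗ[A] M, (∀ x, f (r x) = 0) ∧ ∀ x, f x = 0 → r x = x := by
  -- The image of `f` is finite and torsion-free, hence free, so `M` splits over it.
  have := flat_of_isTorsionFree (A := A) (LinearMap.range f)
  have : Module.Free A (LinearMap.range f) := Module.free_of_flat_of_isLocalRing
  obtain ⟨s, hs⟩ := Module.projective_lifting_property f.rangeRestrict LinearMap.id
    f.surjective_rangeRestrict
  refine ⟨LinearMap.id - s ∘ₗ f.rangeRestrict, fun x ↦ ?_, fun x hx ↦ ?_⟩
  · have := congrArg Subtype.val (LinearMap.congr_fun hs (f.rangeRestrict x))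
    simpa [sub_eq_zero] using this.symm
  · have : f.rangeRestrict x = 0 := Subtype.ext hx
    simp [this]

/-- A version of Nakayama's lemma for the homology of a complex of modules over
a valuation ring. -/
lemma ValuationRing.ker_le_range_of_mem_sup [Module.Finite A M] [Module.IsTorsionFree A N]
    {L : Type*} [AddCommGroup L] [Module A L] (g : L →ₗ[A] M) (f : M →ₗ[A] N)
    (hgf : ∀ x, f (g x) = 0)
    (h : ∀ z, f z = 0 →
      z ∈ IsLocalRing.maximalIdeal A • (⊤ : Submodule A M) ⊔ LinearMap.range g) :
    LinearMap.ker f ≤ LinearMap.range g := by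
  obtain ⟨r, hr, hr'⟩ := exists_projection_ker f
  have hker : LinearMap.ker f = LinearMap.range r := by
    ext x
    exact ⟨fun hx ↦ ⟨x, hr' x hx⟩, by rintro ⟨y, rfl⟩; exact hr y⟩
  refine Submodule.le_of_le_smul_of_le_jacobson_bot (I := IsLocalRing.maximalIdeal A) ?_
    (IsLocalRing.maximalIdeal_le_jacobson _) fun z hz ↦ ?_
  · rw [hker, LinearMap.range_eq_map]
    exact Module.Finite.fg_top.map r
  · obtain ⟨y, hy, _, ⟨w, rfl⟩, rfl⟩ := Submodule.mem_sup.1 (h z hz)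
    -- Applying the projection `r` fixes the cycle and the boundary, and moves the part in `P M`
    -- into `P` times the kernel of `f`, as Nakayama requires.
    rw [← hr' _ hz, map_add, hr' _ (hgf w), add_comm]
    refine Submodule.add_mem_sup ⟨w, rfl⟩ ?_
    rw [hker, LinearMap.range_eq_map, ← Submodule.map_smul'']
    exact Submodule.mem_map_of_mem hy

end LinearAlgebra

namespace ModuleCat

variable {A : Type u} [CommRing A]

lemma exists_eq_add_of_quasiIso {K L : CochainComplex (ModuleCat.{u} A) ℤ} (φ : K ⟶ L)
    [QuasiIso φ] (n : ℤ) (z : L.X n) (hz : L.d n (n + 1) z = 0) :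
    ∃ (y : K.X n) (w : L.X (n - 1)), z = φ.f n y + L.d (n - 1) n w := by
  have h : Epi (HomologicalComplex.homologyMap φ n) := inferInstance
  rw [HomologicalComplex.epi_homologyMap_iff_up_to_refinements φ (n - 1) n (n + 1)
    (by simp) (by simp)] at h
  obtain ⟨A', π, _, x, _, y, hxy⟩ := h (ModuleCat.ofHom (LinearMap.toSpanSingleton A (L.X n) z))
    (ModuleCat.hom_ext (LinearMap.ext_ring (by simpa using hz)))
  obtain ⟨a, ha⟩ := (ModuleCat.epi_iff_surjective π).1 inferInstance (1 : A)
  refine ⟨x a, y a, ?_⟩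
  have := ConcreteCategory.congr_hom hxy a
  simpa [ha] using this

variable [IsDomain A] [ValuationRing A]

/-- Surjectivity of `K ⊗ P ⟶ K` on homology writes each cycle as an element of `P K` plus a
boundary. -/
lemma acyclic_of_quasiIso_complexAugmentation (K : CochainComplex (ModuleCat.{u} A) ℤ)
    (hK : ∀ n, Module.Finite A (K.X n) ∧ Module.Projective A (K.X n))
    [QuasiIso ((CochainComplex.complexAugmentation
      (tensorIdealAugmentation (IsLocalRing.maximalIdeal A))).app K)] : K.Acyclic := by
  intro n
  have := (hK n).1
  have := (hK (n + 1)).2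
  rw [HomologicalComplex.exactAt_iff' K (n - 1) n (n + 1) (by simp) (by simp),
    ShortComplex.moduleCat_exact_iff]
  refine ValuationRing.ker_le_range_of_mem_sup (K.d (n - 1) n).hom (K.d n (n + 1)).hom
    (fun x ↦ ConcreteCategory.congr_hom (K.d_comp_d (n - 1) n (n + 1)) x) fun z hz ↦ ?_
  obtain ⟨y, w, rfl⟩ := exists_eq_add_of_quasiIso ((CochainComplex.complexAugmentation
      (tensorIdealAugmentation (IsLocalRing.maximalIdeal A))).app K) n z hz
  refine Submodule.add_mem_sup ?_ ⟨w, rfl⟩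
  rw [CochainComplex.complexAugmentation_app_f, ← Ideal.range_tensorMul]
  exact ⟨y, rfl⟩

end ModuleCat

/-! ### The localization at the ideal and its kernel -/

namespace Telescope

variable {A : Type u} [CommRing A] [HasDerivedCategory.{w} (ModuleCat.{u} A)]

lemma IsLocalizationFunctor.of_iso {L L' : DMod.{w} A ⥤ DMod.{w} A} (e : L ≅ L')
    (h : IsLocalizationFunctor L) : IsLocalizationFunctor L' := by
  obtain ⟨⟨_, _⟩, η, hη⟩ := h
  refine ⟨⟨Functor.CommShift.ofIso e ℤ, ?_⟩, η ≫ e.hom, fun X ↦ ?_⟩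
  · let := Functor.CommShift.ofIso e ℤ
    have := Functor.CommShift.ofIso_compatibility e ℤ
    exact Functor.isTriangulated_of_iso e
  · obtain ⟨_, h⟩ := hη X
    have : IsIso (L'.map (η.app X)) := (NatIso.isIso_map_iff e _).1 inferInstance
    have h₁ : L.map (η.app X) ≫ e.hom.app (L.obj X) = e.hom.app X ≫ L'.map (η.app X) :=
      e.hom.naturality _
    have h₂ : e.hom.app X ≫ η.app (L'.obj X) = η.app (L.obj X) ≫ L.map (e.hom.app X) :=
      η.naturality _
    have h₃ : L.map (e.hom.app X) ≫ e.hom.app (L'.obj X) =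
      e.hom.app (L.obj X) ≫ L'.map (e.hom.app X) := e.hom.naturality _
    refine ⟨?_, ?_⟩
    · rw [NatTrans.comp_app, Functor.map_comp]
      infer_instance
    · rw [← cancel_epi (e.hom.app X), NatTrans.comp_app, NatTrans.comp_app, Functor.map_comp,
        reassoc_of% h₂, h₃, ← h, reassoc_of% h₁]

lemma PreservesAllCoproducts.of_iso {L L' : DMod.{w} A ⥤ DMod.{w} A} (e : L ≅ L')
    (h : PreservesAllCoproducts L) : PreservesAllCoproducts L' := fun J ↦
  have := h J
  preservesColimitsOfShape_of_natIso e

lemma kernel_eq_of_iso {L L' : DMod.{w} A ⥤ DMod.{w} A} (e : L ≅ L') : kernel L = kernel L' := by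
  ext X
  exact (e.app X).isZero_iff

lemma isLocalizingSubcategory_kernel {L : DMod.{w} A ⥤ DMod.{w} A} [L.CommShift ℤ]
    [L.IsTriangulated] (hL : PreservesAllCoproducts L) : IsLocalizingSubcategory (kernel L) where
  closedUnderIso := inferInstanceAs L.kernelProperty.IsClosedUnderIsomorphisms
  triangulated := inferInstanceAs L.kernelProperty.IsTriangulated
  directSummands := inferInstanceAs L.kernelProperty.IsStableUnderRetracts
  coproducts J :=
    have := hL J
    L.kernelProperty_isClosedUnderColimitsOfShape (Discrete J)

lemma isLocalizingSubcategory_isZero :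
    IsLocalizingSubcategory (fun X : DMod.{w} A ↦ IsZero X) :=
  isLocalizingSubcategory_kernel (L := 𝟭 _) (fun _ ↦ inferInstance)

/-- The zero objects form a localizing subcategory of `C` with all its perfect complexes, yet
without `X`. -/
lemma not_isGeneratedByPerfect {C : ObjectProperty (DMod.{w} A)}
    (hC : IsLocalizingSubcategory C) (h : ∀ X, C X → IsPerfect X → IsZero X)
    {X : DMod.{w} A} (hX : C X) (hX' : ¬ IsZero X) : ¬ IsGeneratedByPerfect C := by
  intro hgen
  have h₁ : (fun X : DMod.{w} A ↦ IsZero X) ≤ C := fun Y hY ↦ by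
    have := hC.closedUnderIso
    have := hC.triangulated
    obtain ⟨Z, hZ, hZ'⟩ := ObjectProperty.exists_prop_of_containsZero C
    exact C.prop_of_iso (hZ.iso hY) hZ'
  have h₂ := hgen _ isLocalizingSubcategory_isZero h₁ h
  rw [← h₂] at hX
  exact hX' hX

section

variable {I : Ideal A} [Module.Flat A I] (hI : IsIdempotentElem I)

/-- The idempotent augmentation of `- ⊗ I` on the derived category. -/
noncomputable abbrev derivedIdempotentAugmentation : IdempotentAugmentation
    (MonoidalCategory.tensorRight (ModuleCat.of A I)).mapDerivedCategory :=
  (ModuleCat.tensorIdealIdempotentAugmentation hI).mapDerivedCategory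

/-- The localization functor attached to a flat idempotent ideal. -/
noncomputable abbrev idealLocalization : DMod.{w} A ⥤ DMod.{w} A :=
  (derivedIdempotentAugmentation.{w} hI).localization

lemma isLocalizationFunctor_idealLocalization :
    IsLocalizationFunctor (idealLocalization.{w} hI) :=
  ⟨(derivedIdempotentAugmentation.{w} hI).exists_isTriangulated_localization,
    (derivedIdempotentAugmentation.{w} hI).unit, fun X ↦
      ⟨(derivedIdempotentAugmentation.{w} hI).isIso_map_unit_app X,
        (derivedIdempotentAugmentation.{w} hI).map_unit_app X⟩⟩

lemma preservesAllCoproducts_idealLocalization :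
    PreservesAllCoproducts (idealLocalization.{w} hI) := fun J ↦
  have := IdempotentAugmentation.isClosedUnderColimitsOfShape_kernelProperty_mapDerivedCategory
    (MonoidalCategory.tensorRight (ModuleCat.of A I)) J
  (derivedIdempotentAugmentation.{w} hI).preservesColimitsOfShape_localization (Discrete J)

/-- `I` is the value of `- ⊗ I` at `A`, and the augmentation is invertible at such values. -/
lemma kernel_idealLocalization_singleFunctor :
    kernel (idealLocalization.{w} hI)
      ((DerivedCategory.singleFunctor (ModuleCat.{u} A) 0).obj (ModuleCat.of A I)) := by
  let F := MonoidalCategory.tensorRight (ModuleCat.of A I)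
  let e : F.mapDerivedCategory.obj
      ((DerivedCategory.singleFunctor (ModuleCat.{u} A) 0).obj (ModuleCat.of A A)) ≅
      (DerivedCategory.singleFunctor (ModuleCat.{u} A) 0).obj (ModuleCat.of A I) :=
    (F.mapDerivedCategorySingleFunctor 0).app _ ≪≫
      (DerivedCategory.singleFunctor (ModuleCat.{u} A) 0).mapIso
        (MonoidalCategory.leftUnitor (ModuleCat.of A I))
  refine IsZero.of_iso ?_ ((idealLocalization.{w} hI).mapIso e.symm)
  rw [IdempotentAugmentation.isZero_localization_obj_iff]
  infer_instance

end

lemma not_isZero_singleFunctor {I : Ideal A} (hI : I ≠ ⊥) :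
    ¬ IsZero ((DerivedCategory.singleFunctor (ModuleCat.{u} A) 0).obj (ModuleCat.of A I)) := by
  intro h
  have : IsZero (ModuleCat.of A I) := by
    rw [IsZero.iff_id_eq_zero]
    exact (DerivedCategory.singleFunctor (ModuleCat.{u} A) 0).map_injective (h.eq_of_src _ _)
  rw [ModuleCat.isZero_iff_subsingleton] at this
  exact hI ((Submodule.subsingleton_iff_eq_bot).1 this)

variable [IsDomain A] [ValuationRing A]

lemma isDerivedTensor_idealLocalization {I : Ideal A} [Module.Flat A I]
    (hI : IsIdempotentElem I) :
    IsDerivedTensor (ModuleCat.of A (A ⧸ I)) (idealLocalization.{w} hI) := by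
  refine ⟨(ModuleCat.tensorIdealIdempotentAugmentation hI).comparison
    (ModuleCat.tensorQuotientCoaugmentation I)
    (ModuleCat.isZero_tensorIdeal_tensorQuotient hI),
    Functor.isLeftDerivedFunctor_of_resolution _ _
      (CochainComplex.resolutionAugmentation (ModuleCat.degreeZeroAugmentation A))
      (fun K ↦ ?_) (fun K ↦ ?_)⟩
  · have := CochainComplex.quasiIso_resolutionAugmentation_app _
      (ModuleCat.epi_degreeZeroAugmentation_app A) K
    infer_instance
  · refine IdempotentAugmentation.isIso_comparison_app _ _ _ _
      (ModuleCat.tensorIdealAugmentation_comp_tensorQuotientCoaugmentation I) fun n ↦ ?_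
    have := ModuleCat.isTorsionFree_resolution A K n
    have := ValuationRing.flat_of_isTorsionFree (A := A) (((CochainComplex.resolutionFunctor
      (ModuleCat.degreeZeroAugmentation A)).obj K).X n)
    exact ModuleCat.shortExact_tensorIdeal I _

lemma isZero_of_kernel_of_isPerfect [Module.Flat A (IsLocalRing.maximalIdeal A)]
    (hI : IsIdempotentElem (IsLocalRing.maximalIdeal A)) {X : DMod.{w} A}
    (hX : kernel (idealLocalization.{w} hI) X) (hX' : IsPerfect X) : IsZero X := by
  obtain ⟨K, -, hK, ⟨e⟩⟩ := hX'
  refine IsZero.of_iso ?_ e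
  rw [DerivedCategory.isZero_Q_obj_iff]
  have h : IsZero ((idealLocalization.{w} hI).obj (DerivedCategory.Q.obj K)) :=
    IsZero.of_iso hX ((idealLocalization.{w} hI).mapIso e.symm)
  rw [IdempotentAugmentation.isZero_localization_obj_iff] at h
  have : QuasiIso ((CochainComplex.complexAugmentation (ModuleCat.tensorIdealAugmentation
      (IsLocalRing.maximalIdeal A))).app K) := ((ModuleCat.tensorIdealIdempotentAugmentation
    hI).isIso_derivedAugmentation_app_Q_obj_iff K).1 h
  exact ModuleCat.acyclic_of_quasiIso_complexAugmentation K hK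

end Telescope

theorem proposition6p4 {A : Type u} [CommRing A] [IsDomain A] [ValuationRing A]
    [HasDerivedCategory.{w} (ModuleCat.{u} A)]
    (hP : ¬ (IsLocalRing.maximalIdeal A).IsPrincipal) :
    ¬ Telescope.TelescopeConjecture.{w} A ∧
    (∃ L : DerivedCategory (ModuleCat.{u} A) ⥤ DerivedCategory (ModuleCat.{u} A),
      Telescope.IsDerivedTensor (ModuleCat.of A (A ⧸ IsLocalRing.maximalIdeal A)) L) ∧
    ∀ L : DerivedCategory (ModuleCat.{u} A) ⥤ DerivedCategory (ModuleCat.{u} A),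
      Telescope.IsDerivedTensor (ModuleCat.of A (A ⧸ IsLocalRing.maximalIdeal A)) L →
        Telescope.IsLocalizationFunctor L ∧
        Telescope.PreservesAllCoproducts L ∧
        Telescope.IsLocalizingSubcategory (Telescope.kernel L) ∧
        Telescope.kernel L ((DerivedCategory.singleFunctor (ModuleCat.{u} A) 0).obj
          (ModuleCat.of A (IsLocalRing.maximalIdeal A))) ∧
        ¬ IsZero ((DerivedCategory.singleFunctor (ModuleCat.{u} A) 0).obj
          (ModuleCat.of A (IsLocalRing.maximalIdeal A))) ∧
        (∀ X : DerivedCategory (ModuleCat.{u} A),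
          Telescope.kernel L X → Telescope.IsPerfect X → IsZero X) ∧
        ¬ Telescope.IsGeneratedByPerfect (Telescope.kernel L) := by
  have hI := ValuationRing.isIdempotentElem_maximalIdeal hP
  have : Module.Flat A (IsLocalRing.maximalIdeal A) := ValuationRing.flat_of_isTorsionFree _
  have hbot : IsLocalRing.maximalIdeal A ≠ ⊥ := fun h ↦ hP (h ▸ bot_isPrincipal)
  have key : ∀ L : DerivedCategory (ModuleCat.{u} A) ⥤ DerivedCategory (ModuleCat.{u} A),
      Telescope.IsDerivedTensor (ModuleCat.of A (A ⧸ IsLocalRing.maximalIdeal A)) L →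
        Telescope.IsLocalizationFunctor L ∧ Telescope.PreservesAllCoproducts L ∧
        Telescope.IsLocalizingSubcategory (Telescope.kernel L) ∧
        Telescope.kernel L = Telescope.kernel (Telescope.idealLocalization.{w} hI) := by
    rintro L ⟨α, _⟩
    obtain ⟨α₀, _⟩ := Telescope.isDerivedTensor_idealLocalization.{w} hI
    -- Left derived functors are unique, so all claims transfer from the explicit localization to an
    -- arbitrary `L`.
    let e : Telescope.idealLocalization.{w} hI ≅ L :=
      Functor.leftDerivedUnique _ _ α₀ α
        (HomologicalComplex.quasiIso (ModuleCat.{u} A) (ComplexShape.up ℤ))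
    have h₁ := (Telescope.isLocalizationFunctor_idealLocalization.{w} hI).of_iso e
    have h₂ := (Telescope.preservesAllCoproducts_idealLocalization.{w} hI).of_iso e
    obtain ⟨_, _⟩ := h₁.1
    exact ⟨h₁, h₂, Telescope.isLocalizingSubcategory_kernel h₂,
      (Telescope.kernel_eq_of_iso e).symm⟩
  have hzero := Telescope.not_isZero_singleFunctor.{w} hbot
  have hmem := Telescope.kernel_idealLocalization_singleFunctor.{w} hI
  have main : ∀ L : DerivedCategory (ModuleCat.{u} A) ⥤ DerivedCategory (ModuleCat.{u} A),
      Telescope.IsDerivedTensor (ModuleCat.of A (A ⧸ IsLocalRing.maximalIdeal A)) L →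
        ¬ Telescope.IsGeneratedByPerfect (Telescope.kernel L) := fun L hL ↦ by
    obtain ⟨_, _, h₃, h₄⟩ := key L hL
    rw [h₄] at h₃ ⊢
    exact Telescope.not_isGeneratedByPerfect h₃
      (fun X ↦ Telescope.isZero_of_kernel_of_isPerfect hI) hmem hzero
  have hder := Telescope.isDerivedTensor_idealLocalization.{w} hI
  refine ⟨fun h ↦ ?_, ⟨_, hder⟩, fun L hL ↦ ?_⟩
  · obtain ⟨h₁, h₂, h₃, _⟩ := key _ hder
    exact main _ hder (h _ h₃ ⟨_, h₁, h₂, rfl⟩)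
  · obtain ⟨h₁, h₂, h₃, h₄⟩ := key L hL
    refine ⟨h₁, h₂, h₃, h₄ ▸ hmem, hzero, fun X hX ↦ ?_, main L hL⟩
    rw [h₄] at hX
    exact Telescope.isZero_of_kernel_of_isPerfect hI hX
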